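/- Let $n\ge 0$, $m\ge 3n+1$, $k\in\{1,2,\dots\}\cup\{\infty\}$, and let $K\subset\mathbb R^n$ be compact. Let $\mathrm{emb}^k(\mathbb R^n,\mathbb R^m)$ be the set of $C^k$ maps $f:\mathbb R^n\to\mathbb R^m$ that are homeomorphisms onto their image and whose differential is injective at every point. Let $\mathrm{emb}^k(K,\mathbb R^m)$ be the set of maps $f:K\to\mathbb R^m$ that are homeomorphisms onto their image and extend to a $C^k$ map on an open neighbourhood of $K$ whose differential is injective at every point of $K$. Let $\mathcal I^k(\mathbb R^n,\mathbb R^m)$ be the set of extendable embeddings, that is, of maps $\Phi\circ L$ with $\Phi$ a $C^k$ diffeomorphism of $\mathbb R^m$ onto itself and $L\in\mathbb R^{m\times n}$ of rank $n$, and let $\mathcal I^k(K,\mathbb R^m)$ be the set of restrictions to $K$ of its elements. Then: (a) for every $f\in\mathrm{emb}^k(\mathbb R^n,\mathbb R^m)$ there is $E\in\mathcal I^k(\mathbb R^n,\mathbb R^m)$ with $E(K)=f(K)$; (b) for every $f\in\mathrm{emb}^k(\mathbb R^n,\mathbb R^m)$ there is a $C^k$ diffeomorphism $\Phi$ of $\mathbb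 R^m$ with $f(x)=\Phi(R(x))$ for all $x\in K$, where $R:\mathbb R^n\to\mathbb R^m$, $R(x)=(x,0)$, is zero padding; (c) $\mathcal I^k(K,\mathbb R^m)=\mathrm{emb}^k(K,\mathbb R^m)$. -/

import Mathlib

open scoped Manifold ContDiff

/-- `ℝᵈ` with its Euclidean structure. -/
abbrev Euc (d : ℕ) : Type := EuclideanSpace ℝ (Fin d)

/-- `embᵏ(ℝⁿ, ℝᵐ)`: the topological embeddings (continuous, injective, with continuous inverse on
the image) that are of class `Cᵏ` and have an injective differential at every point. -/
def EmbC (k : ℕ∞) (n m : ℕ) : Set (Euc n → Euc m) :=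
  {f | Topology.IsEmbedding f ∧ ContDiff ℝ k f ∧ ∀ x, Function.Injective (fderiv ℝ f x)}

/-- `embᵏ(K, ℝᵐ)` for a subset `K` of `ℝⁿ`: the topological embeddings `K → ℝᵐ` that extend to a
`Cᵏ` map on an open neighbourhood of `K` whose differential is injective at every point of `K`.
The extension itself need not be injective off `K`. -/
def EmbCOn (k : ℕ∞) {n : ℕ} (m : ℕ) (K : Set (Euc n)) : Set (K → Euc m) :=
  {f | Topology.IsEmbedding f ∧
    ∃ (U : Set (Euc n)) (g : Euc n → Euc m), IsOpen U ∧ K ⊆ U ∧ ContDiffOn ℝ k g U ∧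
      (∀ x : K, g x = f x) ∧ ∀ x ∈ K, Function.Injective (fderiv ℝ g x)}

/-- `Diffᵏ(ℝᵐ, ℝᵐ)`: the `Cᵏ` diffeomorphisms of `ℝᵐ` onto itself, as functions. -/
def DiffC (k : ℕ∞) (m : ℕ) : Set (Euc m → Euc m) :=
  Set.range fun Φ : Diffeomorph 𝓘(ℝ, Euc m) 𝓘(ℝ, Euc m) (Euc m) (Euc m) k => (Φ : Euc m → Euc m)

/-- The linear maps `ℝⁿ → ℝᵐ` given by an `m × n` matrix of rank `n`, as functions. -/
def FullRank (n m : ℕ) : Set (Euc n → Euc m) :=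
  {l | ∃ L : Matrix (Fin m) (Fin n) ℝ, L.rank = n ∧ l = fun x => Matrix.toEuclideanLin L x}

/-- `ℐᵏ(ℝⁿ, ℝᵐ)`: the extendable embeddings `Φ ∘ L`, with `Φ` a `Cᵏ` diffeomorphism of `ℝᵐ` and
`L` linear of rank `n`. -/
def ExtEmb (k : ℕ∞) (n m : ℕ) : Set (Euc n → Euc m) :=
  {E | ∃ Φ ∈ DiffC k m, ∃ L ∈ FullRank n m, E = Φ ∘ L}

/-- `ℐᵏ(K, ℝᵐ)`: the restrictions to `K` of the extendable embeddings. -/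
def ExtEmbOn (k : ℕ∞) {n : ℕ} (m : ℕ) (K : Set (Euc n)) : Set (K → Euc m) :=
  K.domRestrict '' ExtEmb k n m

/-- Zero padding `x ↦ (x, 0)` from `ℝⁿ` to `ℝᵐ` (used for `n ≤ m`). -/
def zeroPad (n m : ℕ) (x : Euc n) : Euc m :=
  WithLp.toLp 2 fun i : Fin m => if h : (i : ℕ) < n then x ⟨i, h⟩ else 0

/-!
An embedding `f` of a compact `K` has a `Cᵏ` left inverse `r` defined on the whole ambient space
`V`: local left inverses exist by the inverse function theorem and a partition of unity glues them,
since left inverses form a convex set. If `g` is smooth and `C¹`-close to `f`, then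
`y ↦ y + (g - f) (r y)` is therefore a diffeomorphism carrying `f` to `g` on `K`, and one may assume
that `f` is smooth.

For a smooth `f`, the secants `f x - f y` and the tangents `fderiv ℝ f x v` depend on `2 n`
parameters, so some `n`-dimensional subspace `A` contains no nonzero one of them as long as
`n + 2 n < m`. Hence the component `Q ∘ f` of `f` complementary to `A` is still an injective
immersion on `K`, and it has a left inverse `r`. Knowing `x = r (Q (f x))`, a shear along `A` turns
the `A`-component of `f x` into the coordinate `x` itself, so that the image of `K` becomes a graph
over `A`, and a second shear flattens this graph.
-/

open Set Filter Topology Module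

section Cutoff

variable {E F : Type*} [NormedAddCommGroup E] [NormedSpace ℝ E] [FiniteDimensional ℝ E]
  [NormedAddCommGroup F] [NormedSpace ℝ F]

theorem exists_contDiff_hasCompactSupport_eventuallyEq {k : ℕ∞} {K U : Set E} (hK : IsCompact K)
    (hU : IsOpen U) (hKU : K ⊆ U) {g : E → F} (hg : ContDiffOn ℝ k g U) :
    ∃ f : E → F, ContDiff ℝ k f ∧ HasCompactSupport f ∧ f =ᶠ[𝓝ˢ K] g := by
  have : ProperSpace E := FiniteDimensional.proper ℝ E
  obtain ⟨L, hL, hKL, hLU⟩ := exists_compact_between hK hU hKU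
  obtain ⟨χ, hχ_one, hχ_zero, -⟩ := exists_contMDiffMap_one_nhds_of_subset_interior (n := k)
    𝓘(ℝ, E) hK.isClosed hKL
  have hχL : tsupport χ ⊆ L :=
    closure_minimal (fun x hx => by_contra fun hxL => hx (hχ_zero x hxL)) hL.isClosed
  have hχ_compact : HasCompactSupport χ := hL.of_isClosed_subset (isClosed_tsupport _) hχL
  refine ⟨fun x => χ x • g x, contDiff_iff_contDiffAt.2 fun x => ?_, hχ_compact.smul_right, ?_⟩
  · by_cases hx : x ∈ tsupport χ
    · exact χ.contMDiff.contDiff.contDiffAt.smul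
        (hg.contDiffAt (hU.mem_nhds (hLU (hχL hx))))
    · refine (contDiffAt_const (c := (0 : F))).congr_of_eventuallyEq ?_
      filter_upwards [notMem_tsupport_iff_eventuallyEq.1 hx] with y hy
      simp [hy]
  · filter_upwards [hχ_one] with y hy
    simp [hy]

end Cutoff

section LeftInverse

/-- Restricting to the open set where the derivative is invertible makes the inverse `Cᵏ` on its
whole domain; this is what allows `k = ∞`, where `ContDiffAt` does not persist nearby. -/
theorem exists_openPartialHomeomorph_contDiffOn_symm {E F : Type*} [NormedAddCommGroup E]
    [NormedSpace ℝ E] [CompleteSpace E] [NormedAddCommGroup F] [NormedSpace ℝ F]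
    {k : WithTop ℕ∞} (hk : k ≠ 0) {f : E → F} (hf : ContDiff ℝ k f) {e : E ≃L[ℝ] F} {x₀ : E}
    (he : HasFDerivAt f (e : E →L[ℝ] F) x₀) :
    ∃ φ : OpenPartialHomeomorph E F, x₀ ∈ φ.source ∧ φ = f ∧ ContDiffOn ℝ k φ.symm φ.target := by
  let φ := hf.contDiffAt.toOpenPartialHomeomorph f he hk
  let S : Set E := fderiv ℝ f ⁻¹' range ((↑) : (E ≃L[ℝ] F) → E →L[ℝ] F)
  have hS : IsOpen S := ContinuousLinearEquiv.isOpen.preimage (hf.continuous_fderiv hk)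
  refine ⟨φ.restrOpen S hS,
    ⟨hf.contDiffAt.mem_toOpenPartialHomeomorph_source he hk, e, he.fderiv.symm⟩, rfl,
    fun y hy => ?_⟩
  obtain ⟨e', he'⟩ := ((φ.restrOpen S hS).map_target hy).2
  refine ((φ.restrOpen S hS).contDiffAt_symm hy (f₀' := e') ?_
    hf.contDiffAt).contDiffWithinAt
  rw [he']
  exact (hf.differentiable hk _).hasFDerivAt

theorem exists_contDiffOn_local_leftInverse {E V : Type*} [NormedAddCommGroup E]
    [NormedSpace ℝ E] [CompleteSpace E] [NormedAddCommGroup V] [NormedSpace ℝ V]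
    {k : WithTop ℕ∞} (hk : k ≠ 0) {f : E → V} (hf : ContDiff ℝ k f) {x₀ : E}
    (hx₀ : (fderiv ℝ f x₀).HasLeftInverse) :
    ∃ (N : Set E) (W : Set V) (r : V → E), N ∈ 𝓝 x₀ ∧ W ∈ 𝓝 (f x₀) ∧ ContDiffOn ℝ k r W ∧
      ∀ x ∈ N, r (f x) = x := by
  let l := hx₀.leftInverse
  have he : HasFDerivAt (l ∘ f) (ContinuousLinearEquiv.refl ℝ E : E →L[ℝ] E) x₀ := by
    refine (l.hasFDerivAt.comp x₀ (hf.differentiable hk x₀).hasFDerivAt).congr_fderiv ?_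
    ext v
    exact hx₀.leftInverse_leftInverse v
  obtain ⟨φ, hxφ, hφ, hsymm⟩ :=
    exists_openPartialHomeomorph_contDiffOn_symm hk (l.contDiff.comp hf) he
  have hlx₀ : l (f x₀) ∈ φ.target := by simpa only [hφ, Function.comp_apply] using φ.map_source hxφ
  refine ⟨φ.source, l ⁻¹' φ.target, φ.symm ∘ l, φ.open_source.mem_nhds hxφ,
    l.continuous.continuousAt.preimage_mem_nhds (φ.open_target.mem_nhds hlx₀),
    hsymm.comp l.contDiff.contDiffOn fun _ h => h, fun x hx => ?_⟩
  simpa only [hφ, Function.comp_apply] using φ.left_inv hx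

theorem exists_contDiff_leftInvOn {E V : Type*} [NormedAddCommGroup E] [NormedSpace ℝ E]
    [CompleteSpace E] [NormedAddCommGroup V] [NormedSpace ℝ V] [FiniteDimensional ℝ V]
    {k : ℕ∞} (hk : k ≠ 0) {f : E → V} (hf : ContDiff ℝ k f) {K : Set E} (hK : IsCompact K)
    (hinj : InjOn f K) (himm : ∀ x ∈ K, (fderiv ℝ f x).HasLeftInverse) :
    ∃ r : V → E, ContDiff ℝ k r ∧ LeftInvOn r f K := by
  suffices ∃ r : C^k⟮𝓘(ℝ, V), V; 𝓘(ℝ, E), E⟯, ∀ y, r y ∈ {v | ∀ x ∈ K, f x = y → v = x} by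
    obtain ⟨r, hr⟩ := this
    exact ⟨r, r.contMDiff.contDiff, fun x hx => hr (f x) x hx rfl⟩
  refine exists_contMDiffMap_forall_mem_convex_of_local 𝓘(ℝ, V) ?_ fun y => ?_
  · intro y a ha b hb s t _ _ hst x hx hxy
    rw [ha x hx hxy, hb x hx hxy, ← add_smul, hst, one_smul]
  by_cases hy : y ∈ f '' K
  · obtain ⟨x₀, hx₀, rfl⟩ := hy
    obtain ⟨N, W, r, hN, hW, hr, hrf⟩ :=
      exists_contDiffOn_local_leftInverse (mod_cast hk) hf (himm x₀ hx₀)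
    have hfar : IsClosed (f '' (K \ interior N)) :=
      ((hK.diff isOpen_interior).image hf.continuous).isClosed
    have hx₀_far : f x₀ ∉ f '' (K \ interior N) := by
      rintro ⟨x, hx, hxe⟩
      exact hx.2 (hinj hx.1 hx₀ hxe ▸ mem_interior_iff_mem_nhds.2 hN)
    refine ⟨W ∩ (f '' (K \ interior N))ᶜ, inter_mem hW (hfar.isOpen_compl.mem_nhds hx₀_far), r,
      (hr.mono inter_subset_left).contMDiffOn, ?_⟩
    rintro _ hz x hx rfl
    exact hrf x (interior_subset (by_contra fun hxN => hz.2 ⟨x, ⟨hx, hxN⟩, rfl⟩))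
  · refine ⟨(f '' K)ᶜ, (hK.image hf.continuous).isClosed.isOpen_compl.mem_nhds hy, fun _ => 0,
      contMDiffOn_const, ?_⟩
    rintro _ hz x hx rfl
    exact absurd ⟨x, hx, rfl⟩ hz

end LeftInverse

section Smoothing

open MeasureTheory ContinuousLinearMap in
theorem exists_contDiff_infty_forall_norm_fderiv_sub_le {E V : Type*} [NormedAddCommGroup E]
    [NormedSpace ℝ E] [FiniteDimensional ℝ E] [NormedAddCommGroup V] [NormedSpace ℝ V]
    [CompleteSpace V] {f : E → V} (hf : ContDiff ℝ 1 f) (hc : HasCompactSupport f)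
    {ε : ℝ} (hε : 0 < ε) :
    ∃ g : E → V, ContDiff ℝ ∞ g ∧ ∀ x, ‖fderiv ℝ g x - fderiv ℝ f x‖ ≤ ε := by
  borelize E
  let μ : Measure E := Measure.addHaar
  have hdf : Continuous (fderiv ℝ f) := hf.continuous_fderiv one_ne_zero
  obtain ⟨δ, hδ, hfδ⟩ := Metric.uniformContinuous_iff.1
    ((hc.fderiv ℝ).uniformContinuous_of_continuous hdf) ε hε
  let φ : ContDiffBump (0 : E) := ⟨δ / 2, δ, half_pos hδ, half_lt_self hδ⟩
  have hφ : LocallyIntegrable (φ.normed μ) μ := φ.continuous_normed.locallyIntegrable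
  refine ⟨convolution (φ.normed μ) f (lsmul ℝ ℝ) μ,
    φ.hasCompactSupport_normed.contDiff_convolution_left _ φ.contDiff_normed
      hf.continuous.locallyIntegrable, fun x => ?_⟩
  have hderiv : fderiv ℝ (convolution (φ.normed μ) f (lsmul ℝ ℝ) μ) x =
      convolution (φ.normed μ) (fderiv ℝ f) (lsmul ℝ ℝ) μ x := by
    rw [(hc.hasFDerivAt_convolution_right (lsmul ℝ ℝ) hφ hf x).fderiv]
    refine integral_congr_ae (Eventually.of_forall fun t => ?_)
    ext v
    simp [precompR_apply]
  rw [hderiv, ← dist_eq_norm]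
  exact ContDiffBump.dist_normed_convolution_le hdf.aestronglyMeasurable fun y hy =>
    (hfδ (Metric.mem_ball.1 hy)).le

/-- A bijection of normed spaces that is `Cᵏ` in both directions, as a `Cᵏ` diffeomorphism of the
underlying manifolds; this is how the diffeomorphisms below are built. -/
def diffeomorphOfContDiff {V W : Type*} [NormedAddCommGroup V] [NormedSpace ℝ V]
    [NormedAddCommGroup W] [NormedSpace ℝ W] {k : WithTop ℕ∞} (e : V ≃ W) (he : ContDiff ℝ k e)
    (he_symm : ContDiff ℝ k e.symm) : V ≃ₘ^k⟮𝓘(ℝ, V), 𝓘(ℝ, W)⟯ W where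
  toEquiv := e
  contMDiff_toFun := he.contMDiff
  contMDiff_invFun := he_symm.contMDiff

section Perturbation

variable {E V : Type*} [NormedAddCommGroup E] [NormedSpace ℝ E]
  [NormedAddCommGroup V] [NormedSpace ℝ V] [CompleteSpace V]

theorem exists_homeomorph_eq_id_add {u : V → V} {c : NNReal} (hc : c < 1)
    (hu : LipschitzWith c u) : ∃ Ψ : V ≃ₜ V, ∀ y, Ψ y = y + u y := by
  have happrox : ApproximatesLinearOn (fun y => y + u y)
      (ContinuousLinearEquiv.refl ℝ V : V →L[ℝ] V) univ c := fun x _ y _ => by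
    have hsub : x + u x - (y + u y) - (ContinuousLinearEquiv.refl ℝ V : V →L[ℝ] V) (x - y) =
        u x - u y := by
      rw [ContinuousLinearEquiv.coe_refl, ContinuousLinearMap.id_apply]
      abel
    simpa only [hsub] using hu.norm_sub_le x y
  refine ⟨happrox.toHomeomorph _ ?_, fun _ => rfl⟩
  rcases subsingleton_or_nontrivial V with hV | hV
  · exact Or.inl hV
  · have hnorm : ‖((ContinuousLinearEquiv.refl ℝ V).symm : V →L[ℝ] V)‖₊ = 1 :=
      NNReal.eq ContinuousLinearMap.norm_id
    exact Or.inr (by rwa [hnorm, inv_one])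

theorem exists_diffeomorph_eq_id_add {k : WithTop ℕ∞} (hk : k ≠ 0) {u : V → V}
    (hu : ContDiff ℝ k u) {c : NNReal} (hc : c < 1) (hlip : LipschitzWith c u) :
    ∃ Φ : V ≃ₘ^k⟮𝓘(ℝ, V), 𝓘(ℝ, V)⟯ V, ∀ y, Φ y = y + u y := by
  obtain ⟨Ψ, hΨ⟩ := exists_homeomorph_eq_id_add hc hlip
  have hΨk : ContDiff ℝ k Ψ := funext hΨ ▸ contDiff_id.add hu
  have hnorm : ∀ y, ‖-fderiv ℝ u y‖ < 1 := fun y => by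
    rw [norm_neg]
    exact (norm_fderiv_le_of_lipschitz ℝ hlip).trans_lt hc
  let e : V → V ≃L[ℝ] V := fun y =>
    ContinuousLinearEquiv.unitsEquiv ℝ V (Units.oneSub (-fderiv ℝ u y) (hnorm y))
  have he : ∀ y, HasFDerivAt Ψ (e y : V →L[ℝ] V) y := fun y => by
    rw [funext hΨ]
    refine ((hasFDerivAt_id y).add (hu.differentiable hk y).hasFDerivAt).congr_fderiv ?_
    ext v
    simp [e]
  exact ⟨diffeomorphOfContDiff Ψ.toEquiv hΨk (Ψ.contDiff_symm he hΨk), hΨ⟩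

theorem exists_diffeomorph_eqOn_of_lipschitzWith_sub {k : WithTop ℕ∞} (hk : k ≠ 0) {f g : E → V}
    {r : V → E} (hf : ContDiff ℝ k f) (hg : ContDiff ℝ k g) (hr : ContDiff ℝ k r) {ε C : NNReal}
    (hgf : LipschitzWith ε (g - f)) (hrC : LipschitzWith C r) (hεC : ε * C < 1) :
    ∃ Φ : V ≃ₘ^k⟮𝓘(ℝ, V), 𝓘(ℝ, V)⟯ V, ∀ x, r (f x) = x → Φ (f x) = g x := by
  obtain ⟨Φ, hΦ⟩ := exists_diffeomorph_eq_id_add hk ((hg.sub hf).comp hr) hεC (hgf.comp hrC)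
  refine ⟨Φ, fun x hx => ?_⟩
  rw [hΦ, Function.comp_apply, hx, add_sub_cancel]

end Perturbation

theorem exists_pos_forall_injective_of_norm_sub_lt {𝕜 X E V : Type*} [NontriviallyNormedField 𝕜]
    [CompleteSpace 𝕜] [TopologicalSpace X] [NormedAddCommGroup E] [NormedSpace 𝕜 E]
    [FiniteDimensional 𝕜 E] [NormedAddCommGroup V] [NormedSpace 𝕜 V] {D : X → E →L[𝕜] V}
    {K : Set X} (hK : IsCompact K) (hD : ContinuousOn D K)
    (hinj : ∀ x ∈ K, Function.Injective (D x)) :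
    ∃ δ > 0, ∀ x ∈ K, ∀ T : E →L[𝕜] V, ‖T - D x‖ < δ → Function.Injective T := by
  obtain ⟨δ, hδ, hsub⟩ := (hK.image_of_continuousOn hD).exists_thickening_subset_open
    ContinuousLinearMap.isOpen_injective (image_subset_iff.2 hinj)
  refine ⟨δ, hδ, fun x hx T hT => hsub (Metric.mem_thickening_iff.2 ⟨D x, ⟨x, hx, rfl⟩, ?_⟩)⟩
  rwa [dist_eq_norm]

theorem exists_diffeomorph_eqOn_contDiff_infty {E V : Type*} [NormedAddCommGroup E]
    [NormedSpace ℝ E] [FiniteDimensional ℝ E] [NormedAddCommGroup V] [NormedSpace ℝ V]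
    [FiniteDimensional ℝ V] {k : ℕ∞} (hk : k ≠ 0) {f : E → V} (hf : ContDiff ℝ k f)
    (hfc : HasCompactSupport f) {K : Set E} (hK : IsCompact K) (hinj : InjOn f K)
    (himm : ∀ x ∈ K, Function.Injective (fderiv ℝ f x)) :
    ∃ (Φ : V ≃ₘ^k⟮𝓘(ℝ, V), 𝓘(ℝ, V)⟯ V) (g : E → V), ContDiff ℝ ∞ g ∧ EqOn (Φ ∘ f) g K ∧
      ∀ x ∈ K, Function.Injective (fderiv ℝ g x) := by
  have hk' : (k : WithTop ℕ∞) ≠ 0 := mod_cast hk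
  have : CompleteSpace E := FiniteDimensional.complete ℝ E
  have : CompleteSpace V := FiniteDimensional.complete ℝ V
  obtain ⟨r₀, hr₀, hr₀f⟩ := exists_contDiff_leftInvOn hk hf hK hinj
    fun x hx => .of_injective_of_finiteDimensional (himm x hx)
  obtain ⟨r, hr, hrc, hrr₀⟩ := exists_contDiff_hasCompactSupport_eventuallyEq
    (hK.image hf.continuous) isOpen_univ (subset_univ _) hr₀.contDiffOn
  have hrf : LeftInvOn r f K := fun x hx =>
    (hrr₀.self_of_nhdsSet (mem_image_of_mem f hx)).trans (hr₀f hx)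
  obtain ⟨C, hC⟩ := ContDiff.lipschitzWith_of_hasCompactSupport hrc hr hk'
  obtain ⟨δ, hδ, hδ_inj⟩ := exists_pos_forall_injective_of_norm_sub_lt hK
    (hf.continuous_fderiv hk').continuousOn himm
  obtain ⟨ε, hε, hεC⟩ := exists_pos_mul_lt one_pos C
  obtain ⟨g, hg, hgf⟩ := exists_contDiff_infty_forall_norm_fderiv_sub_le
    (hf.of_le (mod_cast Order.one_le_iff_ne_zero.2 hk)) hfc (lt_min (half_pos hδ) hε)
  have hgk : ContDiff ℝ k g := hg.of_le (mod_cast le_top)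
  have hgf_lip : LipschitzWith ε (g - f) := by
    have hdf := hf.differentiable hk'
    have hdg := hgk.differentiable hk'
    refine lipschitzWith_of_nnnorm_fderiv_le (𝕜 := ℝ) (hdg.sub hdf) fun x => ?_
    rw [fderiv_sub (hdg x) (hdf x), ← NNReal.coe_le_coe, coe_nnnorm]
    exact (hgf x).trans (min_le_right _ _)
  obtain ⟨Φ, hΦ⟩ := exists_diffeomorph_eqOn_of_lipschitzWith_sub hk' hf hgk hr hgf_lip hC
    (by rwa [mul_comm])
  exact ⟨Φ, g, hg, fun x hx => hΦ x (hrf hx), fun x hx => hδ_inj x hx _ <|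
    (hgf x).trans_lt ((min_le_left _ _).trans_lt (half_lt_self hδ))⟩

end Smoothing

section Whitney

variable {V : Type*} [NormedAddCommGroup V] [NormedSpace ℝ V] [FiniteDimensional ℝ V]
  {ι : Type*} [Countable ι]

theorem exists_forall_apply_ne_of_finrank_lt {X : Type*} [NormedAddCommGroup X] [NormedSpace ℝ X]
    [FiniteDimensional ℝ X] {p : ι → X → V} (hp : ∀ i, ContDiff ℝ 1 (p i))
    (hXV : finrank ℝ X < finrank ℝ V) : ∃ v, ∀ i x, p i x ≠ v := by
  have hdim : dimH (⋃ i, range (p i)) < finrank ℝ V := by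
    rw [dimH_iUnion]
    exact (iSup_le fun i => (hp i).dimH_range_le).trans_lt (Nat.cast_lt.2 hXV)
  obtain ⟨v, hv⟩ := (dense_compl_of_dimH_lt_finrank hdim).nonempty
  exact ⟨v, fun i x hx => hv (mem_iUnion.2 ⟨i, x, hx⟩)⟩

/-- A further direction `a` can be added to a good subspace `A` as soon as `a` has not the form
`b + t • d i y` with `b ∈ A`, and these points depend on `dim A + 1 + dim Y` parameters. -/
theorem exists_submodule_forall_apply_mem_imp_eq_zero [Nonempty ι] {Y : Type*}
    [NormedAddCommGroup Y] [NormedSpace ℝ Y] [FiniteDimensional ℝ Y] {d : ι → Y → V}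
    (hd : ∀ i, ContDiff ℝ 1 (d i)) (j : ℕ) (hj : j + finrank ℝ Y < finrank ℝ V) :
    ∃ A : Submodule ℝ V, finrank ℝ A = j ∧ ∀ i y, d i y ∈ A → d i y = 0 := by
  induction j with
  | zero => exact ⟨⊥, finrank_bot ℝ V, fun _ _ => (Submodule.mem_bot ℝ).1⟩
  | succ j ih =>
    obtain ⟨A, hA, hdA⟩ := ih (by omega)
    obtain ⟨a, ha⟩ := exists_forall_apply_ne_of_finrank_lt
      (p := fun i (z : A × ℝ × Y) => (z.1 : V) + z.2.1 • d i z.2.2)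
      (fun i => (A.subtypeL.contDiff.comp contDiff_fst).add (by fun_prop))
      (by simp only [finrank_prod, finrank_self, hA]; omega)
    have haA : a ∉ A := fun h => ha (Classical.arbitrary ι) (⟨a, h⟩, 0, 0) (by simp)
    refine ⟨A ⊔ Submodule.span ℝ {a}, (Submodule.finrank_sup_span_singleton haA).trans (by rw [hA]),
      fun i y hy => ?_⟩
    obtain ⟨b, hb, c, hc, hbc⟩ := Submodule.mem_sup.1 hy
    obtain ⟨t, rfl⟩ := Submodule.mem_span_singleton.1 hc
    obtain rfl | ht := eq_or_ne t 0
    · exact hdA i y (by simpa [← hbc] using hb)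
    · refine absurd ?_ (ha i (⟨-(t⁻¹ • b), A.neg_mem (A.smul_mem _ hb)⟩, t⁻¹, y))
      simp [← hbc, smul_smul, inv_mul_cancel₀ ht]

theorem exists_submodule_forall_sub_mem_forall_fderiv_mem {E : Type*} [NormedAddCommGroup E]
    [NormedSpace ℝ E] [FiniteDimensional ℝ E] {f : E → V} (hf : ContDiff ℝ 2 f) (j : ℕ)
    (hj : j + 2 * finrank ℝ E < finrank ℝ V) :
    ∃ A : Submodule ℝ V, finrank ℝ A = j ∧ (∀ x y, f x - f y ∈ A → f x = f y) ∧
      ∀ x v, fderiv ℝ f x v ∈ A → fderiv ℝ f x v = 0 := by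
  have hsecant : ContDiff ℝ 1 fun z : E × E => f z.1 - f z.2 := by
    have := hf.of_le one_le_two
    fun_prop
  have htangent : ContDiff ℝ 1 fun z : E × E => fderiv ℝ f z.1 z.2 :=
    hf.contDiff_fderiv_apply (by norm_num [one_add_one_eq_two])
  obtain ⟨A, hA, hdA⟩ := exists_submodule_forall_apply_mem_imp_eq_zero
    (d := fun (i : Bool) => bif i then fun z : E × E => f z.1 - f z.2 else
      fun z => fderiv ℝ f z.1 z.2)
    (Bool.forall_bool.2 ⟨htangent, hsecant⟩) j (by rw [finrank_prod]; omega)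
  exact ⟨A, hA, fun x y h => sub_eq_zero.1 (hdA true (x, y) h), fun x v h => hdA false (x, v) h⟩

end Whitney

section Straighten

/-- The shear `v ↦ v + h (π v)` of a normed space along a linear map `π`, for `h` with values in the
kernel of `π`, so that the inverse is `v ↦ v - h (π v)`. -/
def shear {V W : Type*} [NormedAddCommGroup V] [NormedSpace ℝ V] [NormedAddCommGroup W]
    [NormedSpace ℝ W] {k : WithTop ℕ∞} (π : V →L[ℝ] W) (h : W → V) (hh : ContDiff ℝ k h)
    (hπ : ∀ w, π (h w) = 0) : V ≃ₘ^k⟮𝓘(ℝ, V), 𝓘(ℝ, V)⟯ V :=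
  diffeomorphOfContDiff
    { toFun := fun v => v + h (π v)
      invFun := fun v => v - h (π v)
      left_inv := fun v => by simp [hπ]
      right_inv := fun v => by simp [hπ] }
    (contDiff_id.add (hh.comp π.contDiff)) (contDiff_id.sub (hh.comp π.contDiff))

/-- The first shear moves `f x` parallel to the range of `a` to `a x + (f x - a (l (f x)))`; its
image is then a graph over the range of `a`, which the second shear flattens. -/
theorem exists_diffeomorph_eqOn_linear_of_leftInvOn {E V : Type*} [NormedAddCommGroup E]
    [NormedSpace ℝ E] [NormedAddCommGroup V] [NormedSpace ℝ V] {k : WithTop ℕ∞} {a : E →L[ℝ] V}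
    {l : V →L[ℝ] E} (hla : Function.LeftInverse l a) {f : E → V} (hf : ContDiff ℝ k f) {r : V → E}
    (hr : ContDiff ℝ k r) {K : Set E} (hrf : LeftInvOn r (fun x => f x - a (l (f x))) K) :
    ∃ Φ : V ≃ₘ^k⟮𝓘(ℝ, V), 𝓘(ℝ, V)⟯ V, EqOn (Φ ∘ f) a K := by
  let parallel := shear (ContinuousLinearMap.id ℝ V - a.comp l) (fun w => a (r w - l (f (r w))))
    (k := k) (by fun_prop) (fun w => by simp [hla _])
  let flatten := shear l (fun x => a (l (f x)) - f x) (k := k) (by fun_prop)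
    (fun x => by simp [hla _])
  have hparallel : ∀ x ∈ K, parallel (f x) = a x + (f x - a (l (f x))) := fun x hx => by
    change f x + a (r (f x - a (l (f x))) - l (f (r (f x - a (l (f x)))))) = _
    rw [hrf hx, map_sub]
    abel
  have hflatten : ∀ x, flatten (a x + (f x - a (l (f x)))) = a x := fun x => by
    have hl : l (a x + (f x - a (l (f x)))) = x := by simp [hla _]
    change a x + (f x - a (l (f x))) + (a (l (f (l _))) - f (l _)) = a x
    rw [hl]
    abel
  exact ⟨parallel.trans flatten, fun x hx =>
    (congrArg flatten (hparallel x hx)).trans (hflatten x)⟩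

theorem exists_linearEquiv_forall_apply_mem {𝕜 E V : Type*} [DivisionRing 𝕜] [AddCommGroup E]
    [Module 𝕜 E] [AddCommGroup V] [Module 𝕜 V] [FiniteDimensional 𝕜 V] {ι : E →ₗ[𝕜] V}
    (hι : Function.Injective ι) {A : Submodule 𝕜 V} (hA : finrank 𝕜 A = finrank 𝕜 E) :
    ∃ T : V ≃ₗ[𝕜] V, ∀ x, T (ι x) ∈ A := by
  obtain ⟨T, hT⟩ := Submodule.exists_linearEquiv_restrict_eq
    (LinearEquiv.ofFinrankEq (LinearMap.range ι) A
      ((LinearMap.finrank_range_of_inj hι).trans hA.symm))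
  exact ⟨T, fun x => hT ⟨ι x, LinearMap.mem_range_self ι x⟩ ▸ Submodule.coe_mem _⟩

variable {E V : Type*} [NormedAddCommGroup E] [NormedSpace ℝ E] [FiniteDimensional ℝ E]
  [NormedAddCommGroup V] [NormedSpace ℝ V] [FiniteDimensional ℝ V]

theorem exists_diffeomorph_eqOn_linear_of_contDiff_infty (k : ℕ∞) {g : E → V}
    (hg : ContDiff ℝ ∞ g) {K : Set E} (hK : IsCompact K) (hinj : InjOn g K)
    (himm : ∀ x ∈ K, Function.Injective (fderiv ℝ g x))
    (hdim : 3 * finrank ℝ E < finrank ℝ V) {ι : E →ₗ[ℝ] V} (hι : Function.Injective ι) :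
    ∃ Φ : V ≃ₘ^k⟮𝓘(ℝ, V), 𝓘(ℝ, V)⟯ V, EqOn (Φ ∘ g) ι K := by
  have : CompleteSpace E := FiniteDimensional.complete ℝ E
  obtain ⟨A, hA, hsecant, htangent⟩ := exists_submodule_forall_sub_mem_forall_fderiv_mem
    (contDiff_infty.1 hg 2) (finrank ℝ E) (by omega)
  obtain ⟨T₀, hTA⟩ := exists_linearEquiv_forall_apply_mem hι hA
  let T : V ≃L[ℝ] V := T₀.toContinuousLinearEquiv
  let a : E →L[ℝ] V := T ∘L ι.toContinuousLinearMap
  obtain ⟨l, hla⟩ : a.HasLeftInverse :=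
    .of_injective_of_finiteDimensional (T.injective.comp hι)
  let Q : V →L[ℝ] V := ContinuousLinearMap.id ℝ V - a ∘L l
  have hQA : ∀ v, Q v = 0 → v ∈ A := fun v hv => by
    have hva : v = a (l v) := sub_eq_zero.1 hv
    exact hva ▸ hTA (l v)
  have hQg : ContDiff ℝ ∞ (Q ∘ g) := Q.contDiff.comp hg
  have hQg_inj : InjOn (Q ∘ g) K := fun x hx y hy hxy => hinj hx hy <| hsecant x y <| hQA _ <| by
    rw [map_sub, sub_eq_zero]
    exact hxy
  have hQg_imm : ∀ x ∈ K, Function.Injective (fderiv ℝ (Q ∘ g) x) := fun x hx => by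
    rw [(Q.hasFDerivAt.comp x (hg.differentiable (by simp) x).hasFDerivAt).fderiv]
    refine (injective_iff_map_eq_zero _).2 fun v hv => ?_
    exact (injective_iff_map_eq_zero _).1 (himm x hx) v (htangent x v (hQA _ hv))
  obtain ⟨r, hr, hrQg⟩ := exists_contDiff_leftInvOn ENat.top_ne_zero hQg hK hQg_inj
    fun x hx => .of_injective_of_finiteDimensional (hQg_imm x hx)
  have hk : (k : WithTop ℕ∞) ≤ ∞ := mod_cast le_top
  obtain ⟨Φ, hΦ⟩ := exists_diffeomorph_eqOn_linear_of_leftInvOn hla (hg.of_le hk) (hr.of_le hk) hrQg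
  refine ⟨Φ.trans (diffeomorphOfContDiff T.symm.toEquiv T.symm.contDiff T.contDiff),
    fun x hx => ?_⟩
  exact (congrArg T.symm (hΦ hx)).trans (T.symm_apply_apply (ι x))

theorem exists_diffeomorph_eqOn_comp_linear {k : ℕ∞} (hk : k ≠ 0) {K U : Set E}
    (hK : IsCompact K) (hU : IsOpen U) (hKU : K ⊆ U) {f : E → V} (hf : ContDiffOn ℝ k f U)
    (hinj : InjOn f K) (himm : ∀ x ∈ K, Function.Injective (fderiv ℝ f x))
    (hdim : 3 * finrank ℝ E < finrank ℝ V) {ι : E →ₗ[ℝ] V} (hι : Function.Injective ι) :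
    ∃ Φ : V ≃ₘ^k⟮𝓘(ℝ, V), 𝓘(ℝ, V)⟯ V, EqOn f (Φ ∘ ι) K := by
  obtain ⟨f₁, hf₁, hf₁c, hf₁f⟩ := exists_contDiff_hasCompactSupport_eventuallyEq hK hU hKU hf
  have hf₁_eq : EqOn f₁ f K := hf₁f.self_of_nhdsSet
  have hf₁_imm : ∀ x ∈ K, Function.Injective (fderiv ℝ f₁ x) := fun x hx => by
    rw [(hf₁f.filter_mono (nhds_le_nhdsSet hx)).fderiv_eq]
    exact himm x hx
  obtain ⟨Φ, g, hg, hΦ, hg_imm⟩ :=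
    exists_diffeomorph_eqOn_contDiff_infty hk hf₁ hf₁c hK (hinj.congr hf₁_eq.symm) hf₁_imm
  have hg_inj : InjOn g K :=
    (Φ.injective.comp_injOn (hinj.congr hf₁_eq.symm)).congr hΦ
  obtain ⟨Ψ, hΨ⟩ := exists_diffeomorph_eqOn_linear_of_contDiff_infty k hg hK hg_inj hg_imm hdim hι
  refine ⟨(Φ.trans Ψ).symm, fun x hx => ?_⟩
  have hxι : (Φ.trans Ψ) (f x) = ι x := by
    rw [← hf₁_eq hx, ← hΨ hx, Function.comp_apply, ← hΦ hx]
    rfl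
  exact ((Φ.trans Ψ).toEquiv.eq_symm_apply).2 hxι

end Straighten

section Euclidean

theorem injective_fderiv_diffeomorph {V W : Type*} [NormedAddCommGroup V] [NormedSpace ℝ V]
    [NormedAddCommGroup W] [NormedSpace ℝ W] {k : WithTop ℕ∞} (hk : k ≠ 0)
    (Φ : V ≃ₘ^k⟮𝓘(ℝ, V), 𝓘(ℝ, W)⟯ W) (v : V) : Function.Injective (fderiv ℝ Φ v) := by
  rw [← mfderiv_eq_fderiv]
  exact (Φ.mfderivToContinuousLinearEquiv hk v).injective

theorem rank_eq_card_iff_injective_toEuclideanLin {ι κ 𝕜 : Type*} [Fintype κ] [DecidableEq κ]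
    [RCLike 𝕜] (M : Matrix ι κ 𝕜) :
    M.rank = Fintype.card κ ↔ Function.Injective (Matrix.toEuclideanLin M) := by
  rw [Matrix.rank_eq_finrank_span_cols, eq_comm, ← Set.finrank,
    ← linearIndependent_iff_card_eq_finrank_span, ← Matrix.mulVec_injective_iff]
  exact (((WithLp.equiv 2 _).injective_comp _).trans
    ((WithLp.equiv 2 _).symm.comp_injective _)).symm

/-- `zeroPad` as a linear map, exhibiting it as an element of `FullRank` for `n ≤ m`. -/
def zeroPadLinear (n m : ℕ) : Euc n →ₗ[ℝ] Euc m where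
  toFun := zeroPad n m
  map_add' x y := by
    ext i
    by_cases h : (i : ℕ) < n <;> simp [zeroPad, h]
  map_smul' c x := by
    ext i
    by_cases h : (i : ℕ) < n <;> simp [zeroPad, h]

variable {n m : ℕ} {k : ℕ∞} {K : Set (Euc n)}

theorem mem_fullRank_iff {l : Euc n → Euc m} :
    l ∈ FullRank n m ↔ ∃ L : Euc n →ₗ[ℝ] Euc m, Function.Injective L ∧ l = L := by
  have hrank : ∀ M : Matrix (Fin m) (Fin n) ℝ,
      M.rank = n ↔ Function.Injective (Matrix.toEuclideanLin M) := fun M => by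
    simpa only [Fintype.card_fin] using rank_eq_card_iff_injective_toEuclideanLin M
  simp only [FullRank, mem_ofPred_eq, hrank]
  exact (Matrix.toEuclideanLin (𝕜 := ℝ)).toEquiv.exists_congr_right
    (q := fun L : Euc n →ₗ[ℝ] Euc m => Function.Injective L ∧ l = L)

theorem zeroPad_mem_fullRank (hnm : n ≤ m) : zeroPad n m ∈ FullRank n m := by
  refine mem_fullRank_iff.2 ⟨zeroPadLinear n m, fun x y hxy => ?_, rfl⟩
  ext i
  simpa [zeroPadLinear, zeroPad] using congrArg (fun z : Euc m => z (Fin.castLE hnm i)) hxy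

theorem extEmb_subset_embC (hk : k ≠ 0) : ExtEmb k n m ⊆ EmbC k n m := by
  rintro _ ⟨_, ⟨Φ, rfl⟩, l, hl, rfl⟩
  obtain ⟨L, hL, rfl⟩ := mem_fullRank_iff.1 hl
  have hk' : (k : WithTop ℕ∞) ≠ 0 := mod_cast hk
  have hL_smooth : ContDiff ℝ k L := L.toContinuousLinearMap.contDiff
  refine ⟨Φ.toHomeomorph.isEmbedding.comp
    (LinearMap.isClosedEmbedding_of_injective (LinearMap.ker_eq_bot.2 hL)).isEmbedding,
    Φ.contDiff.comp hL_smooth, fun x => ?_⟩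
  have hderiv : HasFDerivAt (Φ ∘ L) (fderiv ℝ Φ (L x) ∘L L.toContinuousLinearMap) x :=
    (Φ.contDiff.differentiable hk' (L x)).hasFDerivAt.comp x L.toContinuousLinearMap.hasFDerivAt
  rw [hderiv.fderiv]
  exact (injective_fderiv_diffeomorph hk' Φ (L x)).comp hL

theorem domRestrict_mem_embCOn {f : Euc n → Euc m} (hf : f ∈ EmbC k n m) :
    K.domRestrict f ∈ EmbCOn k m K :=
  ⟨hf.1.comp .subtypeVal, univ, f, isOpen_univ, subset_univ K, hf.2.1.contDiffOn, fun _ => rfl,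
    fun x _ => hf.2.2 x⟩

theorem exists_diffC_of_mem_embCOn (hk : k ≠ 0) (hm : 3 * n < m) (hK : IsCompact K)
    {f : K → Euc m} (hf : f ∈ EmbCOn k m K) {l : Euc n → Euc m} (hl : l ∈ FullRank n m) :
    ∃ Φ ∈ DiffC k m, ∀ x : K, f x = Φ (l x) := by
  obtain ⟨hf_emb, U, g, hU, hKU, hg, hgf, hg_imm⟩ := hf
  obtain ⟨L, hL, rfl⟩ := mem_fullRank_iff.1 hl
  have hg_inj : InjOn g K := injOn_iff_injective.2 <| by
    rw [show K.domRestrict g = f from funext hgf]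
    exact hf_emb.injective
  obtain ⟨Φ, hΦ⟩ := exists_diffeomorph_eqOn_comp_linear hk hK hU hKU hg hg_inj hg_imm
    (by simpa only [finrank_euclideanSpace_fin]) hL
  exact ⟨Φ, ⟨Φ, rfl⟩, fun x => (hgf x).symm.trans (hΦ x.2)⟩

theorem extEmbOn_eq_embCOn (hk : k ≠ 0) (hm : 3 * n < m) (hK : IsCompact K) :
    ExtEmbOn k m K = EmbCOn k m K := by
  refine Subset.antisymm ?_ fun f hf => ?_
  · rintro _ ⟨E, hE, rfl⟩
    exact domRestrict_mem_embCOn (extEmb_subset_embC hk hE)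
  have hpad : zeroPad n m ∈ FullRank n m := zeroPad_mem_fullRank (by omega)
  obtain ⟨Φ, hΦ, hfΦ⟩ := exists_diffC_of_mem_embCOn hk hm hK hf hpad
  exact ⟨Φ ∘ zeroPad n m, ⟨Φ, hΦ, _, hpad, rfl⟩, funext fun x => (hfΦ x).symm⟩

end Euclidean

theorem mainTheorem2 (n m : ℕ) (hm : 3 * n + 1 ≤ m) (k : ℕ∞) (hk : 1 ≤ k)
    (K : Set (Euc n)) (hK : IsCompact K) :
    (∀ f ∈ EmbC k n m, ∃ E ∈ ExtEmb k n m, E '' K = f '' K) ∧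
    (∀ f ∈ EmbC k n m, ∃ Φ ∈ DiffC k m, ∀ x ∈ K, f x = Φ (zeroPad n m x)) ∧
    ExtEmbOn k m K = EmbCOn k m K := by
  have hk₀ : k ≠ 0 := Order.one_le_iff_ne_zero.1 hk
  have hpad : zeroPad n m ∈ FullRank n m := zeroPad_mem_fullRank (by omega)
  have hb : ∀ f ∈ EmbC k n m, ∃ Φ ∈ DiffC k m, ∀ x ∈ K, f x = Φ (zeroPad n m x) := fun f hf => by
    obtain ⟨Φ, hΦ, hfΦ⟩ := exists_diffC_of_mem_embCOn hk₀ hm hK (domRestrict_mem_embCOn hf) hpad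
    exact ⟨Φ, hΦ, fun x hx => hfΦ ⟨x, hx⟩⟩
  refine ⟨fun f hf => ?_, hb, extEmbOn_eq_embCOn hk₀ hm hK⟩
  obtain ⟨Φ, hΦ, hfΦ⟩ := hb f hf
  exact ⟨Φ ∘ zeroPad n m, ⟨Φ, hΦ, _, hpad, rfl⟩, image_congr fun x hx => (hfΦ x hx).symm⟩
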